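/- Let $\mathbb C$ be a pretopos, i.e. a Barr-exact category with finite limits and finite coproducts that is extensive. Let $\mathsf{PreOrd}(\mathbb C)$ be the category of internal preorders in $\mathbb C$: objects are pairs $(A,\rho)$ with $\rho\rightrightarrows A$ a reflexive and transitive internal relation (jointly monic pair), and morphisms $(A,\rho)\to(B,\sigma)$ are pairs $f\colon A\to B$, $\hat f\colon\rho\to\sigma$ compatible with the projections. An internal preorder is called trivial if it is both an equivalence relation and a partial order (equivalently, $\rho$ is the discrete relation $\Delta_A$), and a morphism of $\mathsf{PreOrd}(\mathbb C)$ is called trivial if it factors through a trivial object. A subobject $A'\rightarrowtail A$ is complemented if there is a subobject $A'^c\rightarrowtail A$ with $A'\cap A'^c=0$ and $A'\cup A'^c=A$. Let $\mathsf{PaPreOrd}(\mathbb C)$ be the category with the same objects, in which a morphism $A\rightharpoonup B$ is a pair $(\alpha,f)$ consisting of a complemented subobject $\alpha\colon A'\rightarrowtail A$ in $\mathsf{PreOrd}(\mathbb C)$ and a morphism $f\colon A'\to B$ in $\mathsf{PreOrd}(\mathbb C)$ (up to isomorphism of the domain $A'$ over $A$), composed by means of pullbacks. Call two parallel morphisms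 $(\alpha_1,f_1),(\alpha_2,f_2)\colon A\rightharpoonup B$, with domains $A_1,A_2$, equivalent if there is a complemented subobject $A_0$ of $A$ which is also (compatibly) a complemented subobject of $A_1$ and of $A_2$, such that $f_1$ and $f_2$ agree on $A_0$ and each $f_i$ is a trivial morphism when restricted to the complement of $A_0$ in $A_i$. The stable category $\mathsf{Stab}(\mathbb C)$ is the quotient of $\mathsf{PaPreOrd}(\mathbb C)$ by this congruence. Then $\mathsf{Stab}(\mathbb C)$ has a zero object and has binary coproducts, and its binary coproducts are disjoint: for every coproduct $A\xrightarrow{\,i\,}A\amalg B\xleftarrow{\,j\,}B$ in $\mathsf{Stab}(\mathbb C)$, the coprojections $i$ and $j$ are monomorphisms, and the pullback of $i$ and $j$ exists and is the zero object, i.e. the square formed by the unique morphisms $0\to A$, $0\to B$ together with $i$ and $j$ is a pullback. -/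

import Mathlib

open CategoryTheory CategoryTheory.Limits

universe v u

attribute [-instance] CategoryTheory.catToReflQuiver

namespace StableCategory

/-! ### Pretoposes -/

/-- A pretopos: a Barr-exact category (regular, and every internal equivalence relation is a
kernel pair) that has finite coproducts and is extensive. -/
class IsPretopos (C : Type u) [Category.{v} C] : Prop
    extends Regular C, FinitaryExtensive C where
  exists_isKernelPair : ∀ {R A : C} (p₁ p₂ : R ⟶ A), IsEquivalenceRelation p₁ p₂ →
    ∃ (B : C) (q : A ⟶ B), IsKernelPair q p₁ p₂

/-! ### Coproduct decompositions in an extensive category -/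

section Cover

variable {D : Type u} [Category.{v} D] [HasPullbacks D] [FinitaryExtensive D]
  {ι : Type} [Finite ι] {F : Discrete ι ⥤ D} {c : Cocone F}

theorem cover_isColimit (hc : IsColimit c) {T : D} (x : T ⟶ c.pt) :
    Nonempty (IsColimit (Cofan.mk T (fun j : ι => pullback.fst x (c.ι.app ⟨j⟩)))) := by
  refine (FinitaryExtensive.isVanKampen_finiteCoproducts hc).isUniversal
    (Cofan.mk T (fun j : ι => pullback.fst x (c.ι.app ⟨j⟩)))
    (Discrete.natTrans (fun j => pullback.snd x (c.ι.app ⟨j.as⟩))) x ?_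
    (.of_discrete _) ?_
  · ext j
    simpa using! pullback.condition.symm
  · intro j
    exact IsPullback.of_hasPullback x (c.ι.app j)

theorem cover_ext (hc : IsColimit c) {T W : D} (x : T ⟶ c.pt) (f g : T ⟶ W)
    (h : ∀ (j : Discrete ι) (S : D) (s : S ⟶ T) (x' : S ⟶ F.obj j),
      s ≫ x = x' ≫ c.ι.app j → s ≫ f = s ≫ g) : f = g := by
  obtain ⟨h'⟩ := cover_isColimit hc x
  exact Cofan.IsColimit.hom_ext h' _ _ fun j => h ⟨j⟩ _ _ _ pullback.condition

theorem cover_glue (hc : IsColimit c) {T W : D} (x : T ⟶ c.pt)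
    (P : ∀ S : D, (S ⟶ T) → (S ⟶ W) → Prop)
    (h : ∀ (j : Discrete ι) (S : D) (s : S ⟶ T) (x' : S ⟶ F.obj j),
      s ≫ x = x' ≫ c.ι.app j → ∃ w : S ⟶ W, P S s w) :
    ∃ w : T ⟶ W, ∀ j : ι, P _ (pullback.fst x (c.ι.app ⟨j⟩))
      (pullback.fst x (c.ι.app ⟨j⟩) ≫ w) := by
  obtain ⟨h'⟩ := cover_isColimit hc x
  choose w hw using fun j : ι => h ⟨j⟩ _ _ _ (pullback.condition (f := x) (g := c.ι.app ⟨j⟩))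
  refine ⟨Cofan.IsColimit.desc h' w, fun j => ?_⟩
  have := Cofan.IsColimit.fac h' w j
  simp only [Cofan.inj, Cofan.mk_ι_app] at this
  rw [this]
  exact hw j

end Cover

section Binary

variable {D : Type u} [Category.{v} D] {A A' B : D} {α : A ⟶ B} {α' : A' ⟶ B}

theorem binary_desc (h : IsColimit (BinaryCofan.mk α α')) {W : D} (f : A ⟶ W) (g : A' ⟶ W) :
    ∃ k : B ⟶ W, α ≫ k = f ∧ α' ≫ k = g := by
  obtain ⟨k, hk, hk'⟩ := BinaryCofan.IsColimit.desc' h f g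
  exact ⟨k, hk, hk'⟩

theorem binary_hom_ext (h : IsColimit (BinaryCofan.mk α α')) {W : D} {f g : B ⟶ W}
    (e : α ≫ f = α ≫ g) (e' : α' ≫ f = α' ≫ g) : f = g :=
  BinaryCofan.IsColimit.hom_ext h e e'

theorem binary_isColimit
    (h : ∀ {W : D} (f : A ⟶ W) (g : A' ⟶ W), ∃ k : B ⟶ W, α ≫ k = f ∧ α' ≫ k = g)
    (h' : ∀ {W : D} (f g : B ⟶ W), α ≫ f = α ≫ g → α' ≫ f = α' ≫ g → f = g) :
    Nonempty (IsColimit (BinaryCofan.mk α α')) := by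
  refine ⟨BinaryCofan.IsColimit.mk _ (fun f g => (h f g).choose)
    (fun f g => (h f g).choose_spec.1) (fun f g => (h f g).choose_spec.2)
    (fun {W} f g m hm hm' => ?_)⟩
  exact h' (W := W) m _ (Eq.trans hm (h f g).choose_spec.1.symm)
    (Eq.trans hm' (h f g).choose_spec.2.symm)

theorem binary_cover_ext [HasPullbacks D] [FinitaryExtensive D]
    (hc : IsColimit (BinaryCofan.mk α α')) {T W : D} (x : T ⟶ B) (f g : T ⟶ W)
    (h : ∀ (S : D) (s : S ⟶ T) (x' : S ⟶ A), s ≫ x = x' ≫ α → s ≫ f = s ≫ g)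
    (h' : ∀ (S : D) (s : S ⟶ T) (x' : S ⟶ A'), s ≫ x = x' ≫ α' → s ≫ f = s ≫ g) :
    f = g := by
  refine cover_ext hc x f g ?_
  rintro ⟨_ | _⟩ S s x' hx
  · exact h S s x' hx
  · exact h' S s x' hx

end Binary

/-! ### Complemented subobjects -/

section Complemented

variable {D : Type u} [Category.{v} D]

/-- The monomorphisms `α` and `α'` represent complementary subobjects of `B`: their intersection
is an initial object and their union is `B` (every subobject of `B` that contains both
is the whole of `B`). -/
structure IsComplement {A A' B : D} (α : A ⟶ B) (α' : A' ⟶ B) : Prop where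
  mono : Mono α
  mono' : Mono α'
  inter : ∃ (Z : D) (p : Z ⟶ A) (q : Z ⟶ A'), Nonempty (IsInitial Z) ∧ IsPullback p q α α'
  union : ∀ (S : D) (m : S ⟶ B), Mono m → (∃ a : A ⟶ S, a ≫ m = α) →
    (∃ a' : A' ⟶ S, a' ≫ m = α') → IsIso m

/-- The morphism `α` represents a complemented subobject of `B`. -/
def IsComplemented {A B : D} (α : A ⟶ B) : Prop :=
  ∃ (A' : D) (α' : A' ⟶ B), IsComplement α α'

variable [HasPullbacks D] [FinitaryExtensive D]

theorem isComplement_iff {A A' B : D} (α : A ⟶ B) (α' : A' ⟶ B) :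
    IsComplement α α' ↔ Nonempty (IsColimit (BinaryCofan.mk α α')) := by
  constructor
  · intro h
    have := h.mono
    have := h.mono'
    obtain ⟨Z, p, q, ⟨hZ⟩, hP⟩ := h.inter
    have key : ∀ {S : D} (a : S ⟶ A) (a' : S ⟶ A'), a ≫ α = a' ≫ α' →
        ∀ {W : D} (f g : S ⟶ W), f = g := fun a a' e _ f g =>
      (hZ.ofStrict (hP.lift a a' e)).hom_ext f g
    have hm : Mono (coprod.desc α α') := by
      refine ⟨fun {T} x y hxy => ?_⟩
      have hxy' : ∀ {S : D} (s : S ⟶ T), s ≫ x ≫ coprod.desc α α' = s ≫ y ≫ coprod.desc α α' :=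
        fun s => congr(s ≫ $hxy)
      refine binary_cover_ext (coprodIsCoprod A A') x x y (fun S s x' hx => ?_)
        (fun S s x' hx => ?_)
      · refine binary_cover_ext (coprodIsCoprod A A') (s ≫ y) _ _ (fun S' s' y' hy => ?_)
          (fun S' s' y' hy => ?_)
        · have e : (s' ≫ x') ≫ α = y' ≫ α := by
            have := hxy' (s' ≫ s)
            simp only [Category.assoc] at this hy
            rw [reassoc_of% hx, reassoc_of% hy, coprod.inl_desc] at this
            simpa only [Category.assoc] using this
          rw [cancel_mono] at e
          rw [hx, hy, ← e, Category.assoc]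
        · refine key (s' ≫ x') y' ?_ _ _
          have := hxy' (s' ≫ s)
          simp only [Category.assoc] at this hy
          rw [reassoc_of% hx, reassoc_of% hy, coprod.inl_desc, coprod.inr_desc] at this
          simpa only [Category.assoc] using this
      · refine binary_cover_ext (coprodIsCoprod A A') (s ≫ y) _ _ (fun S' s' y' hy => ?_)
          (fun S' s' y' hy => ?_)
        · refine key y' (s' ≫ x') ?_ _ _
          have := hxy' (s' ≫ s)
          simp only [Category.assoc] at this hy
          rw [reassoc_of% hx, reassoc_of% hy, coprod.inl_desc, coprod.inr_desc] at this
          simpa only [Category.assoc] using this.symm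
        · have e : (s' ≫ x') ≫ α' = y' ≫ α' := by
            have := hxy' (s' ≫ s)
            simp only [Category.assoc] at this hy
            rw [reassoc_of% hx, reassoc_of% hy, coprod.inr_desc] at this
            simpa only [Category.assoc] using this
          rw [cancel_mono] at e
          rw [hx, hy, ← e, Category.assoc]
    have hi : IsIso (coprod.desc α α') := h.union _ _ hm
      ⟨coprod.inl, coprod.inl_desc _ _⟩ ⟨coprod.inr, coprod.inr_desc _ _⟩
    refine binary_isColimit (fun f g => ⟨inv (coprod.desc α α') ≫ coprod.desc f g, ?_, ?_⟩)
      (fun f g e e' => ?_)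
    · rw [← coprod.inl_desc_assoc α α', IsIso.hom_inv_id_assoc, coprod.inl_desc]
    · rw [← coprod.inr_desc_assoc α α', IsIso.hom_inv_id_assoc, coprod.inr_desc]
    · rw [← cancel_epi (coprod.desc α α')]
      apply coprod.hom_ext
      · rwa [coprod.inl_desc_assoc, coprod.inl_desc_assoc]
      · rwa [coprod.inr_desc_assoc, coprod.inr_desc_assoc]
  · rintro ⟨h⟩
    refine ⟨FinitaryExtensive.mono_inl_of_isColimit h, FinitaryExtensive.mono_inr_of_isColimit h,
      ⟨_, _, _, ⟨initialIsInitial⟩, FinitaryExtensive.isPullback_initial_to_binaryCofan h⟩, ?_⟩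
    rintro S m hm ⟨a, ha⟩ ⟨a', ha'⟩
    obtain ⟨s, hs, hs'⟩ := binary_desc h a a'
    have : s ≫ m = 𝟙 B := by
      apply binary_hom_ext h
      · rw [reassoc_of% hs, ha, Category.comp_id]
      · rw [reassoc_of% hs', ha', Category.comp_id]
    have : IsSplitEpi m := ⟨⟨⟨s, this⟩⟩⟩
    exact isIso_of_mono_of_isSplitEpi m

theorem isComplemented_id (A : D) : IsComplemented (𝟙 A) := by
  refine ⟨⊥_ D, initial.to A, (isComplement_iff _ _).2 ?_⟩
  rw [BinaryCofan.isColimit_iff_isIso_inl initialIsInitial]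
  exact inferInstanceAs (IsIso (𝟙 A))

theorem isComplemented_comp {A B E : D} {β : E ⟶ A} {α : A ⟶ B} (hβ : IsComplemented β)
    (hα : IsComplemented α) : IsComplemented (β ≫ α) := by
  obtain ⟨E', β', hβ⟩ := hβ
  obtain ⟨A', α', hα⟩ := hα
  obtain ⟨hβ⟩ := (isComplement_iff _ _).1 hβ
  obtain ⟨hα⟩ := (isComplement_iff _ _).1 hα
  refine ⟨E' ⨿ A', coprod.desc (β' ≫ α) α', (isComplement_iff _ _).2
    (binary_isColimit (fun f g => ?_) (fun f g e e' => ?_))⟩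
  · obtain ⟨k, hk, hk'⟩ := binary_desc hβ f (coprod.inl ≫ g)
    obtain ⟨l, hl, hl'⟩ := binary_desc hα k (coprod.inr ≫ g)
    refine ⟨l, by rw [Category.assoc, hl, hk], ?_⟩
    apply coprod.hom_ext
    · rw [coprod.inl_desc_assoc, Category.assoc, hl, hk']
    · rw [coprod.inr_desc_assoc, hl']
  · apply binary_hom_ext hα
    · apply binary_hom_ext hβ
      · simpa only [Category.assoc] using e
      · have := congr(coprod.inl ≫ $e')
        rwa [coprod.inl_desc_assoc, coprod.inl_desc_assoc, Category.assoc,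
          Category.assoc] at this
    · have := congr(coprod.inr ≫ $e')
      rwa [coprod.inr_desc_assoc, coprod.inr_desc_assoc] at this

theorem isComplemented_pullback_fst {X A B : D} (f : X ⟶ B) {α : A ⟶ B}
    (hα : IsComplemented α) : IsComplemented (pullback.fst f α) := by
  obtain ⟨A', α', hα⟩ := hα
  obtain ⟨hα⟩ := (isComplement_iff _ _).1 hα
  refine ⟨pullback f α', pullback.fst f α', (isComplement_iff _ _).2 ?_⟩
  exact ((BinaryCofan.isVanKampen_iff _).1 (FinitaryExtensive.vanKampen _ hα)
    (BinaryCofan.mk (pullback.fst f α) (pullback.fst f α')) (pullback.snd f α)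
    (pullback.snd f α') f pullback.condition.symm pullback.condition.symm).2
    ⟨IsPullback.of_hasPullback f α, IsPullback.of_hasPullback f α'⟩

end Complemented

/-! ### Internal preorders -/

section Preorders

variable (C : Type u) [Category.{v} C]

/-- The parallel pairs `r₁, r₂ : ρ ⇉ A` (with `ρ` the value at `zero`, `A` the value at `one`,
`r₁` and `r₂` the images of `left` and `right`) that are internal preorders: `(r₁, r₂)` is a
relation on `A`, i.e. it is jointly monic, and it is reflexive and transitive. -/
def isPreorder : ObjectProperty (WalkingParallelPair ⥤ C) := fun F =>
  Nonempty (ReflexiveRelation (F.map .left) (F.map .right)) ∧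
    Nonempty (TransitiveRelation (F.map .left) (F.map .right))

/-- The category of internal preorders `(A, ρ)` in `C`. A morphism `(A, ρ) ⟶ (B, σ)` is a natural
transformation of parallel pairs, i.e. a pair `f : A ⟶ B`, `f' : ρ ⟶ σ` with
`r₁ ≫ f = f' ≫ s₁` and `r₂ ≫ f = f' ≫ s₂`. -/
abbrev PreOrd := (isPreorder C).FullSubcategory

variable {C}

namespace PreOrd

/-- The underlying object `A` of an internal preorder `(A, ρ)`. -/
abbrev carrier (X : PreOrd C) : C := X.obj.obj .one

/-- The relation `ρ` of an internal preorder `(A, ρ)`. -/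
abbrev rel (X : PreOrd C) : C := X.obj.obj .zero

/-- The first projection of the relation. -/
abbrev r₁ (X : PreOrd C) : X.rel ⟶ X.carrier := X.obj.map .left

/-- The second projection of the relation. -/
abbrev r₂ (X : PreOrd C) : X.rel ⟶ X.carrier := X.obj.map .right

end PreOrd

theorem isPreorder_iff [HasPullbacks C] (F : WalkingParallelPair ⥤ C) :
    isPreorder C F ↔
      (∀ (T : C) (x y : T ⟶ F.obj .zero), x ≫ F.map .left = y ≫ F.map .left →
        x ≫ F.map .right = y ≫ F.map .right → x = y) ∧
      (∀ (T : C) (a : T ⟶ F.obj .one), ∃ e : T ⟶ F.obj .zero,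
        e ≫ F.map .left = a ∧ e ≫ F.map .right = a) ∧
      (∀ (T : C) (x y : T ⟶ F.obj .zero), x ≫ F.map .right = y ≫ F.map .left →
        ∃ z : T ⟶ F.obj .zero, z ≫ F.map .left = x ≫ F.map .left ∧
          z ≫ F.map .right = y ≫ F.map .right) := by
  constructor
  · rintro ⟨⟨h⟩, ⟨h'⟩⟩
    refine ⟨fun T x y e e' => h.right_cancellation x y e e',
      fun T a => ⟨a ≫ h.r, by simp, by simp⟩, fun T x y e => ?_⟩
    refine ⟨PullbackCone.IsLimit.lift h'.isLimit x y e ≫ h'.t, ?_, ?_⟩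
    · rw [Category.assoc, h'.transitivity₁, PullbackCone.IsLimit.lift_fst_assoc]
    · rw [Category.assoc, h'.transitivity₂, PullbackCone.IsLimit.lift_snd_assoc]
  · rintro ⟨h1, h2, h3⟩
    obtain ⟨r, hr, hr'⟩ := h2 _ (𝟙 _)
    obtain ⟨t, ht, ht'⟩ := h3 _ _ _ (pullback.condition (f := F.map .right) (g := F.map .left))
    have hj : JointlyMono₂ (F.map .left) (F.map .right) := ⟨fun {Y} f g => h1 Y f g⟩
    exact ⟨⟨{ hj with r := r, reflexivity₁ := hr, reflexivity₂ := hr' }⟩,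
      ⟨{ hj with
          c := _
          isLimit := pullbackIsPullback _ _
          t := t
          transitivity₁ := ht
          transitivity₂ := ht' }⟩⟩

instance isPreorder_closedUnderLimits (J : Type) [Category.{0} J] [HasPullbacks C]
    [HasLimitsOfShape J C] : (isPreorder C).IsClosedUnderLimitsOfShape J where
  limitsOfShape_le := by
    rintro X ⟨p⟩
    have hd := fun j => (isPreorder_iff _).1 (p.prop_diag_obj j)
    have l0 := isLimitOfPreserves ((evaluation _ C).obj WalkingParallelPair.zero) p.isLimit
    have l1 := isLimitOfPreserves ((evaluation _ C).obj WalkingParallelPair.one) p.isLimit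
    have ext0 : ∀ {T : C} (x y : T ⟶ X.obj .zero),
        (∀ j, x ≫ (p.π.app j).app .zero = y ≫ (p.π.app j).app .zero) → x = y :=
      fun x y h => l0.hom_ext h
    have ext1 : ∀ {T : C} (x y : T ⟶ X.obj .one),
        (∀ j, x ≫ (p.π.app j).app .one = y ≫ (p.π.app j).app .one) → x = y :=
      fun x y h => l1.hom_ext h
    have lift0 : ∀ {T : C} (x : ∀ j, T ⟶ (p.diag.obj j).obj .zero),
        (∀ j k (f : j ⟶ k), x j ≫ (p.diag.map f).app .zero = x k) →
        ∃ y : T ⟶ X.obj .zero, ∀ j, y ≫ (p.π.app j).app .zero = x j := fun {T} x hx => by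
      let s : Cone (p.diag ⋙ (evaluation _ C).obj WalkingParallelPair.zero) :=
        { pt := T
          π := { app := x, naturality := fun j k f => by
                  exact (Category.id_comp _).trans (hx j k f).symm } }
      exact ⟨l0.lift s, fun j => l0.fac s j⟩
    have nat : ∀ {T : C} (x : T ⟶ X.obj .zero) (j) (m : WalkingParallelPairHom .zero .one),
        (x ≫ (p.π.app j).app .zero) ≫ (p.diag.obj j).map m =
          (x ≫ X.map m) ≫ (p.π.app j).app .one := fun x j m => by
      rw [Category.assoc, Category.assoc]
      exact congrArg (x ≫ ·) ((p.π.app j).naturality m).symm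
    have w1 : ∀ {T : C} (a : T ⟶ X.obj .one) {j k} (f : j ⟶ k),
        (a ≫ (p.π.app j).app .one) ≫ (p.diag.map f).app .one = a ≫ (p.π.app k).app .one :=
      fun a j k f => by
        rw [Category.assoc]
        exact congrArg (a ≫ ·) (NatTrans.congr_app (Cone.w (Cone.mk X p.π) f) .one)
    have nat' : ∀ {T : C} {j k} (f : j ⟶ k) (x : T ⟶ (p.diag.obj j).obj .zero)
        (m : WalkingParallelPairHom .zero .one),
        (x ≫ (p.diag.map f).app .zero) ≫ (p.diag.obj k).map m =
          (x ≫ (p.diag.obj j).map m) ≫ (p.diag.map f).app .one := fun f x m => by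
      rw [Category.assoc, Category.assoc]
      exact congrArg (x ≫ ·) ((p.diag.map f).naturality m).symm
    refine (isPreorder_iff _).2 ⟨fun T x y e e' => ?_, fun T a => ?_, fun T x y e => ?_⟩
    · refine ext0 _ _ fun j => (hd j).1 _ _ _ ?_ ?_
      · rw [nat, nat, e]
      · rw [nat, nat, e']
    · choose z hz hz' using fun j => (hd j).2.1 T (a ≫ (p.π.app j).app .one)
      obtain ⟨y, hy⟩ := lift0 z fun j k f => (hd k).1 _ _ _
        (by rw [nat', hz, hz, w1]) (by rw [nat', hz', hz', w1])
      exact ⟨y, ext1 _ _ fun j => by rw [← nat, hy, hz], ext1 _ _ fun j => by rw [← nat, hy, hz']⟩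
    · choose z hz hz' using fun j => (hd j).2.2 T (x ≫ (p.π.app j).app .zero)
        (y ≫ (p.π.app j).app .zero) (by rw [nat, nat, e])
      obtain ⟨y, hy⟩ := lift0 z fun j k f => (hd k).1 _ _ _
        (by rw [nat', hz, hz, nat, nat, w1]) (by rw [nat', hz', hz', nat, nat, w1])
      exact ⟨y, ext1 _ _ fun j => by rw [← nat, hy, hz, nat],
        ext1 _ _ fun j => by rw [← nat, hy, hz', nat]⟩

instance isPreorder_closedUnderColimits (ι : Type) [Finite ι] [HasPullbacks C]
    [FinitaryExtensive C] : (isPreorder C).IsClosedUnderColimitsOfShape (Discrete ι) where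
  colimitsOfShape_le := by
    rintro X ⟨p⟩
    have hd := fun j => (isPreorder_iff _).1 (p.prop_diag_obj j)
    have : HasColimitsOfShape (Discrete ι) C :=
      hasColimitsOfShape_of_equivalence
        (Discrete.equivalence (Finite.exists_equiv_fin ι).choose_spec.some).symm
    have l0 := isColimitOfPreserves ((evaluation _ C).obj WalkingParallelPair.zero) p.isColimit
    have l1 := isColimitOfPreserves ((evaluation _ C).obj WalkingParallelPair.one) p.isColimit
    have nat : ∀ {T : C} {j} (x : T ⟶ (p.diag.obj j).obj .zero)
        (m : WalkingParallelPairHom .zero .one),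
        (x ≫ (p.ι.app j).app .zero) ≫ X.map m =
          (x ≫ (p.diag.obj j).map m) ≫ (p.ι.app j).app .one := fun x m => by
      rw [Category.assoc, Category.assoc]
      exact congrArg (x ≫ ·) ((p.ι.app _).naturality m).symm
    have sq : ∀ (m : WalkingParallelPairHom .zero .one) (j : Discrete ι),
        IsPullback ((p.ι.app j).app .zero) ((p.diag.obj j).map m) (X.map m)
          ((p.ι.app j).app .one) := fun m j => by
      refine (FinitaryExtensive.isVanKampen_finiteCoproducts l1
        (((evaluation _ C).obj WalkingParallelPair.zero).mapCocone ⟨X, p.ι⟩)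
        { app := fun j => (p.diag.obj j).map m
          naturality := fun j k f => ((p.diag.map f).naturality m).symm } (X.map m) ?_
        (.of_discrete _)).1 ⟨l0⟩ j
      ext j
      exact (p.ι.app j).naturality m
    have factor : ∀ (m : WalkingParallelPairHom .zero .one) {T : C} {j}
        (y : T ⟶ X.obj .zero) (a : T ⟶ (p.diag.obj j).obj .one),
        y ≫ X.map m = a ≫ (p.ι.app j).app .one →
        ∃ y' : T ⟶ (p.diag.obj j).obj .zero, y' ≫ (p.ι.app j).app .zero = y ∧
          y' ≫ (p.diag.obj j).map m = a := fun m T j y a h =>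
      ⟨(sq m j).lift y a h, (sq m j).lift_fst _ _ _, (sq m j).lift_snd _ _ _⟩
    have mono1 : ∀ j, Mono ((p.ι.app j).app .one) := fun j => FinitaryExtensive.mono_ι l1 j
    refine (isPreorder_iff _).2 ⟨fun T x y e e' => ?_, fun T a => ?_, fun T x y e => ?_⟩
    · refine cover_ext l0 x x y fun j S s x' hx => ?_
      replace hx : s ≫ x = x' ≫ (p.ι.app j).app .zero := hx
      obtain ⟨y', hy, hy'⟩ := factor .left (j := j) (s ≫ y) (x' ≫ (p.diag.obj j).map .left) (by
        rw [← nat, ← hx, Category.assoc, Category.assoc, e])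
      rw [hx, ← hy]
      refine congrArg (· ≫ (p.ι.app j).app .zero) ((hd j).1 _ _ _ hy'.symm ?_)
      rw [← cancel_mono ((p.ι.app j).app .one), ← nat, ← nat, hy, ← hx, Category.assoc,
        Category.assoc, e']
    · obtain ⟨z, hz⟩ := cover_glue l1 a (fun S s (w : S ⟶ X.obj .zero) =>
          w ≫ X.map .left = s ≫ a ∧ w ≫ X.map .right = s ≫ a) fun j S s a' ha => by
        obtain ⟨w, hw, hw'⟩ := (hd j).2.1 S a'
        replace ha : s ≫ a = a' ≫ (p.ι.app j).app .one := ha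
        exact ⟨w ≫ (p.ι.app j).app .zero, by rw [nat, hw, ha], by rw [nat, hw', ha]⟩
      obtain ⟨h⟩ := cover_isColimit l1 a
      refine ⟨z, Cofan.IsColimit.hom_ext h _ _ fun j => ?_,
        Cofan.IsColimit.hom_ext h _ _ fun j => ?_⟩
      · exact (Category.assoc _ _ _).symm.trans (hz j).1
      · exact (Category.assoc _ _ _).symm.trans (hz j).2
    · obtain ⟨z, hz⟩ := cover_glue l0 x (fun S s (w : S ⟶ X.obj .zero) =>
          w ≫ X.map .left = s ≫ x ≫ X.map .left ∧ w ≫ X.map .right = s ≫ y ≫ X.map .right)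
          fun j S s x' hx => by
        replace hx : s ≫ x = x' ≫ (p.ι.app j).app .zero := hx
        obtain ⟨y', hy, hy'⟩ := factor .left (j := j) (s ≫ y)
          (x' ≫ (p.diag.obj j).map .right) (by
            rw [← nat, ← hx, Category.assoc, Category.assoc, e])
        obtain ⟨w, hw, hw'⟩ := (hd j).2.2 S x' y' hy'.symm
        refine ⟨w ≫ (p.ι.app j).app .zero, ?_, ?_⟩
        · rw [nat, hw, ← nat, ← hx, Category.assoc]
        · rw [nat, hw', ← nat, hy, Category.assoc]
      obtain ⟨h⟩ := cover_isColimit l0 x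
      refine ⟨z, Cofan.IsColimit.hom_ext h _ _ fun j => ?_,
        Cofan.IsColimit.hom_ext h _ _ fun j => ?_⟩
      · exact (Category.assoc _ _ _).symm.trans (hz j).1
      · exact (Category.assoc _ _ _).symm.trans (hz j).2

instance preOrd_hasPullbacks [HasPullbacks C] : HasPullbacks (PreOrd C) :=
  hasLimitsOfShape_of_closedUnderLimits _ _

instance preOrd_finitaryExtensive [HasPullbacks C] [FinitaryExtensive C] :
    FinitaryExtensive (PreOrd C) := by
  have : HasFiniteCoproducts (PreOrd C) :=
    ⟨fun n => hasColimitsOfShape_of_closedUnderColimits (Discrete (Fin n)) (isPreorder C)⟩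
  exact finitaryExtensive_of_preserves_and_reflects_isomorphism (isPreorder C).ι

/-- The internal equivalence relations. -/
def isEquivalence : ObjectProperty (PreOrd C) := fun X =>
  Nonempty (SymmetricRelation X.r₁ X.r₂)

/-- The internal partial orders: `ρ ∩ ρᵒ` is the discrete relation on `A`. -/
def isPartialOrder [HasBinaryProducts C] : ObjectProperty (PreOrd C) := fun X =>
  ∃ e : X.carrier ⟶ X.rel, e ≫ X.r₁ = 𝟙 _ ∧ e ≫ X.r₂ = 𝟙 _ ∧
    IsPullback e e (prod.lift X.r₁ X.r₂) (prod.lift X.r₂ X.r₁)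

/-- The trivial objects: the preorders that are both equivalence relations and partial orders. -/
def isTrivial [HasBinaryProducts C] : ObjectProperty (PreOrd C) :=
  isEquivalence ⊓ isPartialOrder

/-- The trivial morphisms: those that factor through a trivial object. -/
def IsTrivialHom [HasBinaryProducts C] {X Y : PreOrd C} (f : X ⟶ Y) : Prop :=
  ∃ (Z : PreOrd C) (g : X ⟶ Z) (h : Z ⟶ Y), isTrivial Z ∧ g ≫ h = f

end Preorders

/-! ### Partial morphisms -/

section Partial

variable {D : Type u} [Category.{v} D]

/-- A representative `A ↩ A' ⟶ B` of a partial morphism, where `A' ↪ A` is a complemented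
subobject. -/
structure PartialMap (A B : D) where
  /-- the domain of definition -/
  dom : D
  /-- the inclusion of the domain of definition -/
  inc : dom ⟶ A
  /-- the morphism on the domain of definition -/
  map : dom ⟶ B
  isComplemented : IsComplemented inc

/-- Two representatives define the same partial morphism if they differ by an isomorphism between
the representatives of the complemented subobject. -/
def PartialMap.Rel {A B : D} (p q : PartialMap A B) : Prop :=
  ∃ e : p.dom ≅ q.dom, e.hom ≫ q.inc = p.inc ∧ e.hom ≫ q.map = p.map

/-- Partial morphisms. -/
def PartialHom (A B : D) : Type (max u v) := Quot (PartialMap.Rel (A := A) (B := B))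

theorem PartialMap.mono {A B : D} (p : PartialMap A B) : Mono p.inc := by
  obtain ⟨_, _, h⟩ := p.isComplemented
  exact h.mono

theorem PartialMap.rel_of_hom {A B : D} {p q : PartialMap A B} (s : p.dom ⟶ q.dom)
    (t : q.dom ⟶ p.dom) (hs : s ≫ q.inc = p.inc) (ht : t ≫ p.inc = q.inc)
    (h : s ≫ q.map = p.map) : PartialMap.Rel p q := by
  have := p.mono
  have := q.mono
  refine ⟨⟨s, t, ?_, ?_⟩, hs, h⟩
  · rw [← cancel_mono p.inc, Category.assoc, ht, hs, Category.id_comp]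
  · rw [← cancel_mono q.inc, Category.assoc, hs, ht, Category.id_comp]

theorem PartialMap.rel_equivalence (A B : D) :
    Equivalence (PartialMap.Rel (A := A) (B := B)) where
  refl p := ⟨Iso.refl _, Category.id_comp _, Category.id_comp _⟩
  symm := by
    rintro p q ⟨e, h, h'⟩
    exact ⟨e.symm, by rw [Iso.symm_hom, ← h, e.inv_hom_id_assoc],
      by rw [Iso.symm_hom, ← h', e.inv_hom_id_assoc]⟩
  trans := by
    rintro p q r ⟨e, h, h'⟩ ⟨f, k, k'⟩
    exact ⟨e ≪≫ f, by rw [Iso.trans_hom, Category.assoc, k, h],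
      by rw [Iso.trans_hom, Category.assoc, k', h']⟩

variable [HasPullbacks D] [FinitaryExtensive D]

/-- The identity partial morphism. -/
abbrev PartialMap.id (A : D) : PartialMap A A := ⟨A, 𝟙 A, 𝟙 A, isComplemented_id A⟩

/-- The composite of partial morphisms, through the pullback of the second inclusion along the
first map. -/
noncomputable abbrev PartialMap.comp {A B E : D} (p : PartialMap A B) (q : PartialMap B E) :
    PartialMap A E :=
  ⟨pullback p.map q.inc, pullback.fst p.map q.inc ≫ p.inc, pullback.snd p.map q.inc ≫ q.map,
    isComplemented_comp (isComplemented_pullback_fst _ q.isComplemented) p.isComplemented⟩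

theorem PartialMap.comp_rel {A B E : D} {p p' : PartialMap A B} {q q' : PartialMap B E}
    (hp : PartialMap.Rel p p') (hq : PartialMap.Rel q q') :
    PartialMap.Rel (p.comp q) (p'.comp q') := by
  obtain ⟨e, h, h'⟩ := hp
  obtain ⟨f, k, k'⟩ := hq
  have h2 : e.inv ≫ p.inc = p'.inc := by rw [← h, e.inv_hom_id_assoc]
  have h2' : e.inv ≫ p.map = p'.map := by rw [← h', e.inv_hom_id_assoc]
  have k2 : f.inv ≫ q.inc = q'.inc := by rw [← k, f.inv_hom_id_assoc]
  refine PartialMap.rel_of_hom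
    (pullback.lift (pullback.fst p.map q.inc ≫ e.hom) (pullback.snd p.map q.inc ≫ f.hom)
      (by rw [Category.assoc, Category.assoc, h', k, pullback.condition]))
    (pullback.lift (pullback.fst p'.map q'.inc ≫ e.inv) (pullback.snd p'.map q'.inc ≫ f.inv)
      (by rw [Category.assoc, Category.assoc, h2', k2, pullback.condition])) ?_ ?_ ?_
  · dsimp only [PartialMap.comp]
    rw [pullback.lift_fst_assoc, Category.assoc, h]
  · dsimp only [PartialMap.comp]
    rw [pullback.lift_fst_assoc, Category.assoc, h2]
  · dsimp only [PartialMap.comp]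
    rw [pullback.lift_snd_assoc, Category.assoc, k']

theorem PartialMap.id_comp_rel {A B : D} (p : PartialMap A B) :
    PartialMap.Rel ((PartialMap.id A).comp p) p := by
  refine PartialMap.rel_of_hom (pullback.snd _ _)
    (pullback.lift p.inc (𝟙 _) (by rw [Category.id_comp]; exact Category.comp_id _)) ?_ ?_ ?_
  · exact pullback.condition.symm
  · exact (pullback.lift_fst_assoc _ _ _ _).trans (Category.comp_id _)
  · rfl

theorem PartialMap.comp_id_rel {A B : D} (p : PartialMap A B) :
    PartialMap.Rel (p.comp (PartialMap.id B)) p := by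
  refine PartialMap.rel_of_hom (pullback.fst _ _)
    (pullback.lift (𝟙 _) p.map (by rw [Category.id_comp]; exact (Category.comp_id _).symm))
    ?_ ?_ ?_
  · rfl
  · exact (pullback.lift_fst_assoc _ _ _ _).trans (Category.id_comp _)
  · exact pullback.condition

theorem PartialMap.assoc_rel {A B E F : D} (p : PartialMap A B) (q : PartialMap B E)
    (r : PartialMap E F) : PartialMap.Rel ((p.comp q).comp r) (p.comp (q.comp r)) := by
  refine PartialMap.rel_of_hom
    (pullback.lift (pullback.fst _ _ ≫ pullback.fst p.map q.inc)
      (pullback.lift (pullback.fst _ _ ≫ pullback.snd p.map q.inc) (pullback.snd _ _) ?_) ?_)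
    (pullback.lift (pullback.lift (pullback.fst _ _)
        (pullback.snd _ _ ≫ pullback.fst q.map r.inc) ?_)
      (pullback.snd _ _ ≫ pullback.snd q.map r.inc) ?_) ?_ ?_ ?_
  · rw [Category.assoc]
    exact pullback.condition (f := (p.comp q).map) (g := r.inc)
  · refine Eq.trans ?_ (pullback.lift_fst_assoc _ _ _ _).symm
    rw [Category.assoc, Category.assoc, pullback.condition]
  · rw [Category.assoc]
    exact pullback.condition (f := p.map) (g := (q.comp r).inc)
  · refine (pullback.lift_snd_assoc _ _ _ _).trans ?_
    rw [Category.assoc, Category.assoc, pullback.condition]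
  · dsimp only [PartialMap.comp]
    rw [pullback.lift_fst_assoc, Category.assoc]
  · dsimp only [PartialMap.comp]
    rw [pullback.lift_fst_assoc, pullback.lift_fst_assoc]
  · dsimp only [PartialMap.comp]
    rw [pullback.lift_snd_assoc, pullback.lift_snd_assoc]

variable (D) in
/-- The category of partial morphisms of `D`; it has the same objects as `D`. -/
structure Partial where
  /-- the underlying object of `D` -/
  as : D

noncomputable instance partialCategory : Category.{max u v} (Partial D) where
  Hom A B := PartialHom A.as B.as
  id A := Quot.mk _ (PartialMap.id A.as)
  comp := Quot.map₂ PartialMap.comp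
    (fun p _ _ h => PartialMap.comp_rel ((PartialMap.rel_equivalence _ _).refl p) h)
    (fun _ _ q h => PartialMap.comp_rel h ((PartialMap.rel_equivalence _ _).refl q))
  id_comp := by
    rintro _ _ ⟨p⟩
    exact Quot.sound (PartialMap.id_comp_rel p)
  comp_id := by
    rintro _ _ ⟨p⟩
    exact Quot.sound (PartialMap.comp_id_rel p)
  assoc := by
    rintro _ _ _ _ ⟨p⟩ ⟨q⟩ ⟨r⟩
    exact Quot.sound (PartialMap.assoc_rel p q r)

/-- The partial morphism with a given representative. -/
def PartialMap.toHom {A B : D} (p : PartialMap A B) : Partial.mk A ⟶ Partial.mk B :=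
  Quot.mk _ p

end Partial

/-! ### The stable category -/

section Stable

variable (C : Type u) [Category.{v} C] [HasFiniteLimits C] [FinitaryExtensive C]

variable {C} in
/-- There is a congruence diagram between two representatives `A ↩ A₁ ⟶ B` and `A ↩ A₂ ⟶ B` of
partial morphisms of internal preorders: a complemented subobject `A₀` of `A` that is a
complemented subobject of `A₁` and of `A₂`, on which the two maps agree, such that each map is
trivial on the complement of `A₀` in its domain. -/
def CongruenceDiagram {A B : PreOrd C} (p q : PartialMap A B) : Prop :=
  ∃ (A₀ K L : PreOrd C) (i : A₀ ⟶ A) (j₁ : A₀ ⟶ p.dom) (j₂ : A₀ ⟶ q.dom)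
    (k : K ⟶ p.dom) (l : L ⟶ q.dom),
    IsComplemented i ∧ IsComplement j₁ k ∧ IsComplement j₂ l ∧
    j₁ ≫ p.inc = i ∧ j₂ ≫ q.inc = i ∧ j₁ ≫ p.map = j₂ ≫ q.map ∧
    IsTrivialHom (k ≫ p.map) ∧ IsTrivialHom (l ≫ q.map)

/-- The category of partial morphisms of internal preorders in `C`. -/
abbrev PaPreOrd := Partial (PreOrd C)

/-- Two partial morphisms are equivalent if they have representatives that are related by a
congruence diagram. -/
def stableRel : HomRel (PaPreOrd C) := fun A B f g =>
  ∃ p q : PartialMap A.as B.as, p.toHom = f ∧ q.toHom = g ∧ CongruenceDiagram p q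

/-- The stable category of internal preorders in `C`: the quotient of the category of partial
morphisms by the congruence. -/
abbrev Stab := CategoryTheory.Quotient (stableRel C)

end Stable

end StableCategory

/-!
The disjointness of coproducts is a formal consequence of the rest: in a category with a zero
object every coprojection `i : A ⟶ P` has a retraction that annihilates the other coprojection
`j : B ⟶ P`, so `i` is a monomorphism, and `f ≫ i = g ≫ j` forces `f` and `g` to be zero
(`mono_of_isColimit_of_isZero`, `isPullback_of_isColimit_of_isZero`).

The initial object of an extensive category `D` is strict, which makes it a zero object of the
category `Partial D` of partial morphisms, hence of every quotient of `Partial D`. By extensivity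
a partial morphism out of `A ⨿ B` is the same as a pair of partial morphisms out of `A` and `B`
(`Partial.nonempty_isColimit`), so the coproducts of `D` are coproducts in `Partial D`.

The passage to the stable category keeps these coproducts for the following reason. A quotient
category `P / r` inherits the coproducts of `P` as soon as related morphisms `f` and `g` become
related after adding the identity of an arbitrary object, since then `- ⨿ Z` descends to `P / r`
and turns equalities of morphisms in the quotient into equalities of copairings
(`nonempty_isColimit_quotient`). For the stable category, a congruence diagram between `p` and `q`
with common part `A₀` yields one between `p ⨿ 𝟙 Z` and `q ⨿ 𝟙 Z` with common part `A₀ ⨿ Z` and the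
same complements (`congruenceDiagram_addId`). Neither step requires the defining relation to be a
congruence.
-/

namespace StableCategory

/-! ### Coproducts in categories with a zero object -/

section Zero

variable {E : Type*} [Category* E] {A B P Z : E} {i : A ⟶ P} {j : B ⟶ P}

theorem mono_of_isColimit_of_isZero (h : IsColimit (BinaryCofan.mk i j)) (hZ : IsZero Z) :
    Mono i := by
  obtain ⟨r, hr, -⟩ := binary_desc h (𝟙 A) (hZ.from_ B ≫ hZ.to_ A)
  have : IsSplitMono i := ⟨⟨⟨r, hr⟩⟩⟩
  infer_instance

theorem isColimit_binaryCofan_swap (h : IsColimit (BinaryCofan.mk i j)) :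
    Nonempty (IsColimit (BinaryCofan.mk j i)) :=
  ⟨BinaryCofan.isColimitFlip h⟩

/-- Composing the given square with the retraction of `i` that annihilates `j` exhibits `f` as
the zero morphism. -/
theorem eq_zero_of_comp_inl_eq_comp_inr (h : IsColimit (BinaryCofan.mk i j)) (hZ : IsZero Z) {T : E}
    {f : T ⟶ A} {g : T ⟶ B} (w : f ≫ i = g ≫ j) : f = hZ.from_ T ≫ hZ.to_ A := by
  obtain ⟨r, hr, hr'⟩ := binary_desc h (𝟙 A) (hZ.from_ B ≫ hZ.to_ A)
  calc f = (f ≫ i) ≫ r := by rw [Category.assoc, hr, Category.comp_id]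
    _ = (g ≫ hZ.from_ B) ≫ hZ.to_ A := by rw [w, Category.assoc, hr', Category.assoc]
    _ = hZ.from_ T ≫ hZ.to_ A := congr($(hZ.eq_of_tgt _ _) ≫ _)

theorem isPullback_of_isColimit_of_isZero (h : IsColimit (BinaryCofan.mk i j)) (hZ : IsZero Z) :
    IsPullback (hZ.to_ A) (hZ.to_ B) i j := by
  obtain ⟨h'⟩ := isColimit_binaryCofan_swap h
  exact ⟨⟨hZ.eq_of_src _ _⟩, ⟨PullbackCone.IsLimit.mk _ (fun s => hZ.from_ s.pt)
    (fun s => (eq_zero_of_comp_inl_eq_comp_inr h hZ s.condition).symm)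
    (fun s => (eq_zero_of_comp_inl_eq_comp_inr h' hZ s.condition.symm).symm)
    (fun s m _ _ => hZ.eq_of_tgt _ _)⟩⟩

theorem binaryCoproductsDisjoint_of_hasZeroObject [HasZeroObject E] [HasBinaryCoproducts E] :
    BinaryCoproductsDisjoint E := by
  refine .mk fun X Y => ?_
  have hZ := isZero_zero E
  have hc := coprodIsCoprod X Y
  obtain ⟨hc'⟩ := isColimit_binaryCofan_swap hc
  have : Mono (BinaryCofan.mk (coprod.inl : X ⟶ X ⨿ Y) coprod.inr).inl :=
    mono_of_isColimit_of_isZero hc hZ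
  have : Mono (BinaryCofan.mk (coprod.inl : X ⟶ X ⨿ Y) coprod.inr).inr :=
    mono_of_isColimit_of_isZero hc' hZ
  exact BinaryCoproductDisjoint.of_binaryCofan hc
    (isPullback_of_isColimit_of_isZero hc hZ).isLimit hZ.isInitial

end Zero

/-! ### Zero objects and coproducts in quotient categories -/

section Quotient

variable {P : Type*} [Category* P] (r : HomRel P)

theorem isZero_quotient {Z : P} (hZ : IsZero Z) :
    IsZero ((CategoryTheory.Quotient.functor r).obj Z) := by
  refine ⟨fun Y => ⟨⟨⟨(Quotient.functor r).map (hZ.to_ Y.as)⟩, fun f => ?_⟩⟩,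
    fun Y => ⟨⟨⟨(Quotient.functor r).map (hZ.from_ Y.as)⟩, fun f => ?_⟩⟩⟩
  · obtain ⟨f', rfl⟩ := (Quotient.functor r).map_surjective
      (X := Z) (Y := Y.as) f
    exact congrArg _ (hZ.eq_of_src _ _)
  · obtain ⟨f', rfl⟩ := (Quotient.functor r).map_surjective
      (X := Y.as) (Y := Z) f
    exact congrArg _ (hZ.eq_of_tgt _ _)

variable [HasBinaryCoproducts P] {r}

/-- Existence of copairings in the quotient is clear since the quotient functor is full; uniqueness
needs that the copairing respects equality in the quotient, in each variable. -/
theorem nonempty_isColimit_quotient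
    (hr : ∀ {X Y : P} (f g : X ⟶ Y) (Z : P), r f g →
      (Quotient.functor r).map (coprod.map f (𝟙 Z)) =
        (Quotient.functor r).map (coprod.map g (𝟙 Z))) (X Y : P) :
    Nonempty (IsColimit (BinaryCofan.mk
      ((Quotient.functor r).map (coprod.inl : X ⟶ X ⨿ Y))
      ((Quotient.functor r).map (coprod.inr : Y ⟶ X ⨿ Y)))) := by
  -- `- ⨿ Z` descends to the quotient, so it respects equality there
  have add : ∀ {X Y : P} (f g : X ⟶ Y) (Z : P),
      (Quotient.functor r).map f = (Quotient.functor r).map g →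
      (Quotient.functor r).map (coprod.map f (𝟙 Z)) =
        (Quotient.functor r).map (coprod.map g (𝟙 Z)) := fun f g Z h => by
    have := congrArg (CategoryTheory.Quotient.lift r (coprod.functor.flip.obj Z ⋙ Quotient.functor r)
      (fun _ _ f g h => hr f g Z h)).map h
    exact this
  have desc_left : ∀ {X Y W : P} (f f' : X ⟶ W) (g : Y ⟶ W),
      (Quotient.functor r).map f = (Quotient.functor r).map f' →
      (Quotient.functor r).map (coprod.desc f g) =
        (Quotient.functor r).map (coprod.desc f' g) := fun {X Y W} f f' g h => by
    have e : ∀ k : X ⟶ W, coprod.desc k g = coprod.map k (𝟙 Y) ≫ coprod.desc (𝟙 W) g :=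
      fun k => by simp
    rw [e f, e f', Functor.map_comp, Functor.map_comp, add f f' Y h]
  have desc_right : ∀ {X Y W : P} (f : X ⟶ W) (g g' : Y ⟶ W),
      (Quotient.functor r).map g = (Quotient.functor r).map g' →
      (Quotient.functor r).map (coprod.desc f g) =
        (Quotient.functor r).map (coprod.desc f g') := fun {X Y W} f g g' h => by
    -- the symmetry of the coproduct reduces this to the first variable
    have e : ∀ k : Y ⟶ W, coprod.desc f k = coprod.desc coprod.inr coprod.inl ≫ coprod.desc k f :=
      fun k => coprod.hom_ext
        (by rw [coprod.inl_desc_assoc, coprod.inr_desc, coprod.inl_desc])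
        (by rw [coprod.inr_desc_assoc, coprod.inl_desc, coprod.inr_desc])
    rw [e g, e g', Functor.map_comp, Functor.map_comp, desc_left g g' f h]
  refine binary_isColimit (fun {W} f g => ?_) (fun {W} f g e e' => ?_)
  · obtain ⟨f, rfl⟩ := (Quotient.functor r).map_surjective (X := X) (Y := W.as) f
    obtain ⟨g, rfl⟩ := (Quotient.functor r).map_surjective (X := Y) (Y := W.as) g
    refine ⟨(Quotient.functor r).map (coprod.desc f g), ?_, ?_⟩
    · rw [← Functor.map_comp, coprod.inl_desc]
    · rw [← Functor.map_comp, coprod.inr_desc]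
  · obtain ⟨f, rfl⟩ := (Quotient.functor r).map_surjective (X := X ⨿ Y) (Y := W.as) f
    obtain ⟨g, rfl⟩ := (Quotient.functor r).map_surjective (X := X ⨿ Y) (Y := W.as) g
    rw [← Functor.map_comp, ← Functor.map_comp] at e e'
    have eta : ∀ k : X ⨿ Y ⟶ W.as, k = coprod.desc (coprod.inl ≫ k) (coprod.inr ≫ k) :=
      fun k => by ext <;> simp [coprod.inl_desc, coprod.inr_desc]
    rw [eta f, eta g, desc_left _ _ _ e, desc_right _ _ _ e']

theorem hasBinaryCoproducts_quotient
    (hr : ∀ {X Y : P} (f g : X ⟶ Y) (Z : P), r f g →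
      (Quotient.functor r).map (coprod.map f (𝟙 Z)) =
        (Quotient.functor r).map (coprod.map g (𝟙 Z))) :
    HasBinaryCoproducts (CategoryTheory.Quotient r) := by
  have : ∀ {X Y : CategoryTheory.Quotient r}, HasBinaryCoproduct X Y := fun {X Y} =>
    HasColimit.mk ⟨_, (nonempty_isColimit_quotient hr X.as Y.as).some⟩
  exact hasBinaryCoproducts_of_hasColimit_pair _

end Quotient

/-! ### Coproducts of complemented subobjects -/

section Complemented

variable {D : Type u} [Category.{v} D] [FinitaryExtensive D]

theorem isPullback_coprodMap {A A' B B' : D} (f : A' ⟶ A) (g : B' ⟶ B) :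
    IsPullback coprod.inl f (coprod.map f g) coprod.inl ∧
      IsPullback coprod.inr g (coprod.map f g) coprod.inr :=
  ((BinaryCofan.isVanKampen_iff _).1 (FinitaryExtensive.vanKampen _ (coprodIsCoprod A B))
    (BinaryCofan.mk coprod.inl coprod.inr) f g (coprod.map f g)
    (coprod.inl_map f g).symm (coprod.inr_map f g).symm).1 ⟨coprodIsCoprod A' B'⟩

variable [HasPullbacks D]

theorem isComplement_coprodMap_id {A K B : D} {f : A ⟶ B} {k : K ⟶ B} (h : IsComplement f k)
    (Z : D) : IsComplement (coprod.map f (𝟙 Z)) (k ≫ (coprod.inl : B ⟶ B ⨿ Z)) := by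
  obtain ⟨h⟩ := (isComplement_iff _ _).1 h
  refine (isComplement_iff _ _).2 (binary_isColimit (fun u w => ?_) (fun u w e e' => ?_))
  · obtain ⟨s, hs, hs'⟩ := binary_desc h (coprod.inl ≫ u) w
    exact ⟨coprod.desc s (coprod.inr ≫ u), by ext <;> simp [hs, coprod.inl_desc, coprod.inr_desc],
      by rw [Category.assoc, coprod.inl_desc, hs']⟩
  · apply coprod.hom_ext
    · apply binary_hom_ext h
      · simpa using congr(coprod.inl ≫ $e)
      · simpa using e'
    · simpa using congr(coprod.inr ≫ $e)

theorem isComplemented_coprodMap {A A' B B' : D} {f : A' ⟶ A} {g : B' ⟶ B}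
    (hf : IsComplemented f) (hg : IsComplemented g) : IsComplemented (coprod.map f g) := by
  obtain ⟨F, f', hf⟩ := hf
  obtain ⟨G, g', hg⟩ := hg
  obtain ⟨hf⟩ := (isComplement_iff _ _).1 hf
  obtain ⟨hg⟩ := (isComplement_iff _ _).1 hg
  refine ⟨_, coprod.map f' g', (isComplement_iff _ _).2
    (binary_isColimit (fun u w => ?_) (fun u w e e' => ?_))⟩
  · obtain ⟨s, hs, hs'⟩ := binary_desc hf (coprod.inl ≫ u) (coprod.inl ≫ w)
    obtain ⟨t, ht, ht'⟩ := binary_desc hg (coprod.inr ≫ u) (coprod.inr ≫ w)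
    exact ⟨coprod.desc s t, by ext <;> simp [hs, ht, coprod.inl_desc, coprod.inr_desc],
      by ext <;> simp [hs', ht', coprod.inl_desc, coprod.inr_desc]⟩
  · apply coprod.hom_ext
    · apply binary_hom_ext hf
      · simpa using congr(coprod.inl ≫ $e)
      · simpa using congr(coprod.inl ≫ $e')
    · apply binary_hom_ext hg
      · simpa using congr(coprod.inr ≫ $e)
      · simpa using congr(coprod.inr ≫ $e')

end Complemented

/-! ### The zero object and coproducts of the category of partial morphisms -/

section Partial

variable {D : Type u} [Category.{v} D] [HasPullbacks D] [FinitaryExtensive D]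

theorem PartialMap.toHom_eq {A B : D} {p q : PartialMap A B} (h : PartialMap.Rel p q) :
    p.toHom = q.toHom :=
  Quot.sound h

theorem exists_toHom_eq {A B : Partial D} (f : A ⟶ B) :
    ∃ p : PartialMap A.as B.as, p.toHom = f :=
  Quot.exists_rep f

/-- A total morphism as a partial one. -/
abbrev PartialMap.ofHom {A B : D} (f : A ⟶ B) : PartialMap A B := ⟨A, 𝟙 A, f, isComplemented_id A⟩

theorem PartialMap.comp_ofHom {A B E : D} (p : PartialMap A B) (g : B ⟶ E) :
    p.toHom ≫ (PartialMap.ofHom g).toHom =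
      PartialMap.toHom ⟨p.dom, p.inc, p.map ≫ g, p.isComplemented⟩ := by
  refine PartialMap.toHom_eq (p := p.comp (PartialMap.ofHom g))
    (PartialMap.rel_of_hom (pullback.fst _ _)
      (pullback.lift (𝟙 _) p.map ((Category.id_comp _).trans (Category.comp_id _).symm)) rfl ?_ ?_)
  · exact (pullback.lift_fst_assoc _ _ _ _).trans (Category.id_comp _)
  · exact (pullback.condition_assoc _).trans congr(_ ≫ $(Category.id_comp g))

/-- Restriction of a partial morphism `q` along a total morphism `f`: its domain is the inverse
image of the domain of `q`. -/
theorem PartialMap.ofHom_comp {A B E : D} {f : A ⟶ B} {q : PartialMap B E} {p : PartialMap A E}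
    {t : p.dom ⟶ q.dom} (h : IsPullback t p.inc q.inc f) (ht : t ≫ q.map = p.map) :
    (PartialMap.ofHom f).toHom ≫ q.toHom = p.toHom := by
  refine PartialMap.toHom_eq (p := (PartialMap.ofHom f).comp q)
    (PartialMap.rel_of_hom (h.lift (pullback.snd _ _) (pullback.fst _ _) pullback.condition.symm)
      (pullback.lift p.inc t h.w.symm) ?_ ?_ ?_)
  · exact (h.lift_snd _ _ _).trans (Category.comp_id _).symm
  · exact (pullback.lift_fst_assoc _ _ _ _).trans (Category.comp_id _)
  · rw [← ht]
    exact h.lift_fst_assoc _ _ _ _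

theorem Partial.isZero_mk_initial : IsZero (Partial.mk (⊥_ D)) := by
  refine ⟨fun Y => ⟨⟨⟨(PartialMap.ofHom (initial.to Y.as)).toHom⟩, fun f => ?_⟩⟩,
    fun Y => ⟨⟨⟨PartialMap.toHom ⟨⊥_ D, initial.to Y.as, 𝟙 _, ?_⟩⟩, fun f => ?_⟩⟩⟩
  · obtain ⟨p, rfl⟩ := exists_toHom_eq f
    have hp : IsInitial p.dom := initialIsInitial.ofStrict p.inc
    exact PartialMap.toHom_eq (PartialMap.rel_of_hom (hp.to _) (initial.to _)
      (hp.hom_ext _ _) (initial.hom_ext _ _) (hp.hom_ext _ _))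
  · refine ⟨Y.as, 𝟙 _, (isComplement_iff _ _).2 ?_⟩
    rw [BinaryCofan.isColimit_iff_isIso_inr initialIsInitial]
    exact inferInstanceAs (IsIso (𝟙 Y.as))
  · obtain ⟨p, rfl⟩ := exists_toHom_eq f
    have hp : IsInitial p.dom := initialIsInitial.ofStrict p.map
    exact PartialMap.toHom_eq (PartialMap.rel_of_hom (hp.to _) (initial.to _)
      (hp.hom_ext _ _) (initial.hom_ext _ _) (hp.hom_ext _ _))

/-- The copairing of partial morphisms, defined on the coproduct of their domains. -/
noncomputable abbrev PartialMap.desc {A B W : D} (p : PartialMap A W) (q : PartialMap B W) :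
    PartialMap (A ⨿ B) W :=
  ⟨p.dom ⨿ q.dom, coprod.map p.inc q.inc, coprod.desc p.map q.map,
    isComplemented_coprodMap p.isComplemented q.isComplemented⟩

theorem PartialMap.inl_desc {A B W : D} (p : PartialMap A W) (q : PartialMap B W) :
    (PartialMap.ofHom (coprod.inl : A ⟶ A ⨿ B)).toHom ≫ (p.desc q).toHom = p.toHom :=
  PartialMap.ofHom_comp (isPullback_coprodMap p.inc q.inc).1 (coprod.inl_desc _ _)

theorem PartialMap.inr_desc {A B W : D} (p : PartialMap A W) (q : PartialMap B W) :
    (PartialMap.ofHom (coprod.inr : B ⟶ A ⨿ B)).toHom ≫ (p.desc q).toHom = q.toHom :=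
  PartialMap.ofHom_comp (isPullback_coprodMap p.inc q.inc).2 (coprod.inr_desc _ _)

theorem PartialMap.desc_rel {A B W : D} {p p' : PartialMap A W} {q q' : PartialMap B W}
    (hp : PartialMap.Rel p p') (hq : PartialMap.Rel q q') :
    PartialMap.Rel (p.desc q) (p'.desc q') := by
  obtain ⟨e, h, h'⟩ := hp
  obtain ⟨f, k, k'⟩ := hq
  exact ⟨coprod.mapIso e f, by ext <;> simp [h, k], by ext <;> simp [h', k']⟩

/-- By extensivity, a partial morphism out of `A ⨿ B` is the copairing of its restrictions. -/
theorem PartialMap.desc_restrict {A B W : D} (h : PartialMap (A ⨿ B) W) :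
    PartialMap.Rel (((PartialMap.ofHom (coprod.inl : A ⟶ A ⨿ B)).comp h).desc
      ((PartialMap.ofHom (coprod.inr : B ⟶ A ⨿ B)).comp h)) h := by
  -- the inverse images of the two summands exhibit the domain of `h` as a coproduct
  obtain ⟨hc⟩ := ((BinaryCofan.isVanKampen_iff _).1
    (FinitaryExtensive.vanKampen _ (coprodIsCoprod A B))
    (BinaryCofan.mk (pullback.snd (coprod.inl : A ⟶ A ⨿ B) h.inc)
      (pullback.snd (coprod.inr : B ⟶ A ⨿ B) h.inc))
    (pullback.fst _ _) (pullback.fst _ _) h.inc pullback.condition pullback.condition).2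
    ⟨(IsPullback.of_hasPullback _ _).flip, (IsPullback.of_hasPullback _ _).flip⟩
  obtain ⟨k, hk, hk'⟩ := binary_desc hc coprod.inl coprod.inr
  refine PartialMap.rel_of_hom (coprod.desc (pullback.snd _ _) (pullback.snd _ _)) k ?_ ?_ ?_
  · ext <;> simp [pullback.condition, coprod.inl_desc, coprod.inr_desc]
  · apply binary_hom_ext hc
    · rw [reassoc_of% hk]
      simp [pullback.condition]
    · rw [reassoc_of% hk']
      simp [pullback.condition]
  · ext <;> simp

theorem Partial.nonempty_isColimit (A B : D) :
    Nonempty (IsColimit (BinaryCofan.mk (PartialMap.ofHom (coprod.inl : A ⟶ A ⨿ B)).toHom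
      (PartialMap.ofHom (coprod.inr : B ⟶ A ⨿ B)).toHom)) := by
  refine binary_isColimit (fun f g => ?_) (fun f g e e' => ?_)
  · obtain ⟨p, rfl⟩ := exists_toHom_eq f
    obtain ⟨q, rfl⟩ := exists_toHom_eq g
    exact ⟨(p.desc q).toHom, p.inl_desc q, p.inr_desc q⟩
  · obtain ⟨p, rfl⟩ := exists_toHom_eq f
    obtain ⟨q, rfl⟩ := exists_toHom_eq g
    have e₁ := (PartialMap.rel_equivalence _ _).quot_mk_eq_iff _ _ |>.1 e
    have e₂ := (PartialMap.rel_equivalence _ _).quot_mk_eq_iff _ _ |>.1 e'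
    rw [← PartialMap.toHom_eq p.desc_restrict, ← PartialMap.toHom_eq q.desc_restrict]
    exact PartialMap.toHom_eq (PartialMap.desc_rel e₁ e₂)

instance Partial.hasBinaryCoproducts : HasBinaryCoproducts (Partial D) := by
  have : ∀ {X Y : Partial D}, HasBinaryCoproduct X Y := fun {X Y} =>
    HasColimit.mk ⟨_, (Partial.nonempty_isColimit X.as Y.as).some⟩
  exact hasBinaryCoproducts_of_hasColimit_pair _

/-- The coproduct of a partial morphism with the identity of `Z`. -/
noncomputable abbrev PartialMap.addId {A B : D} (p : PartialMap A B) (Z : D) :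
    PartialMap (A ⨿ Z) (B ⨿ Z) :=
  ⟨p.dom ⨿ Z, coprod.map p.inc (𝟙 Z), coprod.map p.map (𝟙 Z),
    isComplemented_coprodMap p.isComplemented (isComplemented_id Z)⟩

/-- `PartialMap.addId` represents `coprod.map p (𝟙 Z)`, up to the comparison between the chosen
coproducts of `Partial D` and those of `D`. -/
theorem PartialMap.exists_coprodMap_eq (A B Z : D) :
    ∃ (u : Partial.mk A ⨿ Partial.mk Z ⟶ Partial.mk (A ⨿ Z))
      (w : Partial.mk (B ⨿ Z) ⟶ Partial.mk B ⨿ Partial.mk Z),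
      ∀ p : PartialMap A B,
        coprod.map p.toHom (𝟙 (Partial.mk Z)) = u ≫ (p.addId Z).toHom ≫ w := by
  obtain ⟨w, hw, hw'⟩ := binary_desc (Partial.nonempty_isColimit B Z).some coprod.inl coprod.inr
  refine ⟨coprod.desc (PartialMap.ofHom coprod.inl).toHom (PartialMap.ofHom coprod.inr).toHom, w,
    fun p => ?_⟩
  have hl : (PartialMap.ofHom (coprod.inl : A ⟶ A ⨿ Z)).toHom ≫ (p.addId Z).toHom =
      p.toHom ≫ (PartialMap.ofHom (coprod.inl : B ⟶ B ⨿ Z)).toHom := by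
    rw [PartialMap.comp_ofHom]
    exact PartialMap.ofHom_comp (isPullback_coprodMap p.inc (𝟙 Z)).1 (coprod.inl_map _ _)
  have hr : (PartialMap.ofHom (coprod.inr : Z ⟶ A ⨿ Z)).toHom ≫ (p.addId Z).toHom =
      (PartialMap.ofHom (coprod.inr : Z ⟶ B ⨿ Z)).toHom :=
    PartialMap.ofHom_comp (isPullback_coprodMap p.inc (𝟙 Z)).2
      ((coprod.inr_map _ _).trans (Category.id_comp _))
  apply coprod.hom_ext
  · rw [coprod.inl_map, coprod.inl_desc_assoc, reassoc_of% hl, hw]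
  · rw [coprod.inr_map, coprod.inr_desc_assoc, reassoc_of% hr, hw', Category.id_comp]

end Partial

/-! ### The stable category -/

section Stable

theorem IsTrivialHom.comp_right {C : Type u} [Category.{v} C] [HasFiniteLimits C]
    {X Y W : PreOrd C} {f : X ⟶ Y} (hf : IsTrivialHom f) (g : Y ⟶ W) :
    IsTrivialHom (f ≫ g) := by
  obtain ⟨Z, a, b, hZ, rfl⟩ := hf
  exact ⟨Z, a, b ≫ g, hZ, (Category.assoc _ _ _).symm⟩

variable {C : Type u} [Category.{v} C] [HasFiniteLimits C] [FinitaryExtensive C]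

theorem congruenceDiagram_addId {A B : PreOrd C} {p q : PartialMap A B}
    (h : CongruenceDiagram p q) (Z : PreOrd C) :
    CongruenceDiagram (p.addId Z) (q.addId Z) := by
  obtain ⟨A₀, K, L, i, j₁, j₂, k, l, hi, hk, hl, e₁, e₂, e, tk, tl⟩ := h
  refine ⟨A₀ ⨿ Z, K, L, coprod.map i (𝟙 Z), coprod.map j₁ (𝟙 Z), coprod.map j₂ (𝟙 Z),
    k ≫ coprod.inl, l ≫ coprod.inl, isComplemented_coprodMap hi (isComplemented_id Z),
    isComplement_coprodMap_id hk Z, isComplement_coprodMap_id hl Z, ?_, ?_, ?_, ?_, ?_⟩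
  · rw [coprod.map_map, e₁, Category.comp_id]
  · rw [coprod.map_map, e₂, Category.comp_id]
  · rw [coprod.map_map, coprod.map_map, e]
  · rw [Category.assoc, coprod.inl_map, ← Category.assoc]
    exact tk.comp_right _
  · rw [Category.assoc, coprod.inl_map, ← Category.assoc]
    exact tl.comp_right _

theorem map_coprodMap_eq_of_stableRel {X Y : PaPreOrd C} (f g : X ⟶ Y) (Z : PaPreOrd C)
    (h : stableRel C f g) :
    (Quotient.functor (stableRel C)).map (coprod.map f (𝟙 Z)) =
      (Quotient.functor (stableRel C)).map (coprod.map g (𝟙 Z)) := by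
  obtain ⟨p, q, rfl, rfl, h⟩ := h
  obtain ⟨u, w, huw⟩ := PartialMap.exists_coprodMap_eq X.as Y.as Z.as
  have e : (Quotient.functor (stableRel C)).map (p.addId Z.as).toHom =
      (Quotient.functor (stableRel C)).map (q.addId Z.as).toHom :=
    CategoryTheory.Quotient.sound _ ⟨_, _, rfl, rfl, congruenceDiagram_addId h Z.as⟩
  refine (congrArg _ (huw p)).trans (Eq.trans ?_ (congrArg _ (huw q)).symm)
  rw [Functor.map_comp, Functor.map_comp, Functor.map_comp, Functor.map_comp, e]

theorem Stab.hasZeroObject : HasZeroObject (Stab C) :=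
  ⟨_, isZero_quotient (stableRel C) Partial.isZero_mk_initial⟩

theorem Stab.hasBinaryCoproducts : HasBinaryCoproducts (Stab C) :=
  hasBinaryCoproducts_quotient map_coprodMap_eq_of_stableRel

end Stable

end StableCategory

theorem mainTheorem7 (C : Type u) [Category.{v} C] [StableCategory.IsPretopos C] :
    HasZeroObject (StableCategory.Stab C) ∧
    HasBinaryCoproducts (StableCategory.Stab C) ∧
    BinaryCoproductsDisjoint (StableCategory.Stab C) ∧
    ∀ (A B P : StableCategory.Stab C) (i : A ⟶ P) (j : B ⟶ P),
      Nonempty (IsColimit (BinaryCofan.mk i j)) →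
        Mono i ∧ Mono j ∧
        ∀ (Z : StableCategory.Stab C) (hZ : IsZero Z),
          IsPullback (hZ.to_ A) (hZ.to_ B) i j := by
  have hzero := StableCategory.Stab.hasZeroObject (C := C)
  have hcoprod := StableCategory.Stab.hasBinaryCoproducts (C := C)
  refine ⟨hzero, hcoprod, StableCategory.binaryCoproductsDisjoint_of_hasZeroObject, ?_⟩
  rintro A B P i j ⟨h⟩
  obtain ⟨h'⟩ := StableCategory.isColimit_binaryCofan_swap h
  exact ⟨StableCategory.mono_of_isColimit_of_isZero h (isZero_zero _),
    StableCategory.mono_of_isColimit_of_isZero h' (isZero_zero _),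
    fun Z hZ => StableCategory.isPullback_of_isColimit_of_isZero h hZ⟩
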